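/- Let $C=C[0,1]$ be the space of continuous real functions on $[0,1]$ with the maximum norm and $L=L_1[0,1]$ the space of integrable real functions on $[0,1]$ with the norm $\|z\|_L=\int_0^1|z(s)|\,ds$. Let $p:(0,1]\to\mathbb R$ be a positive function that is integrable on $[\varepsilon,1]$ for every $\varepsilon\in(0,1)$ and satisfies $\lim_{\varepsilon\to0+}\int_\varepsilon^1p(t)\,dt=\infty$. Let $k>0$, and put $x_1(t)=\exp\bigl(k\int_t^1p(s)\,ds\bigr)$ for $t\in(0,1]$. Let $D_+$ be the set of all functions $x:[0,1]\to\mathbb R$ with $x(0)=0$ for which there is $f\in L$ such that $x$ is absolutely continuous on $[\varepsilon,1]$ for every $\varepsilon\in(0,1)$, $\dot x(t)=-k\,p(t)x(t)+f(t)$ for almost all $t\in(0,1]$, and $x(1)=\int_0^1\frac{f(s)}{x_1(s)}\,ds$. (All such functions are continuous on $[0,1]$.) For a bounded linear operator $T:C\to L$ consider the Cauchy problem $$\dot x(t)=-k\,p(t)x(t)+(Tx)(t)+f(t)\ \text{ for almost all } t\in[0,1],\qquad x(0)=0. \tag{1}$$ Problem (1) is called uniquely solvable in $D_+$ if for every $f\in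 L$ it has exactly one solution $x\in D_+$. A linear operator $C\to L$ is called positive if it maps nonnegative functions to almost everywhere nonnegative functions. **Theorem.** Let $\mathcal T^+\ge0$ and $\mathcal T^-\ge0$ be given real numbers. Problem (1) is uniquely solvable in $D_+$ for all operators $T=T^+-T^-$ such that $T^+,T^-:C\to L$ are positive linear operators with $\|T^+\|_{C\to L}=\mathcal T^+$ and $\|T^-\|_{C\to L}=\mathcal T^-$ if and only if $$\mathcal T^+\le1\quad\text{and}\quad \mathcal T^-\le2\sqrt{1-\mathcal T^+}.$$ -/

import Mathlib

open MeasureTheory Set Filter Topology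

noncomputable section

namespace SingularFDE

/-- The Banach space `C = C[0,1]` of continuous real functions on `[0,1]`, with the maximum norm. -/
abbrev SpaceC : Type := C(Icc (0 : ℝ) 1, ℝ)

/-- The Banach space `L = L₁[0,1]` of integrable real functions on `[0,1]`, with the `L₁` norm. -/
abbrev SpaceL : Type := Lp ℝ 1 (volume.restrict (Icc (0 : ℝ) 1))

/-- An element of `C[0,1]` regarded as a function of a real variable, constant to the left of `0`
and to the right of `1`. Only its values on `[0,1]`, and its derivative inside `(0,1)`, are used. -/
def toFun (x : SpaceC) : ℝ → ℝ := IccExtend (zero_le_one (α := ℝ)) x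

/-- An operator `C → L` is positive if it maps nonnegative functions to
almost everywhere nonnegative functions. -/
def IsPositiveOp (T : SpaceC →L[ℝ] SpaceL) : Prop :=
  ∀ x : SpaceC, (∀ t, 0 ≤ x t) → ∀ᵐ t ∂(volume.restrict (Icc (0 : ℝ) 1)), 0 ≤ T x t

/-- The conditions on the coefficient `p : (0,1] → ℝ`: it is positive, it is integrable on every
`[ε,1]` with `0 < ε < 1`, and `∫_ε^1 p → ∞` as `ε → 0+`. -/
structure IsSingularCoeff (p : ℝ → ℝ) : Prop where
  pos : ∀ t ∈ Ioc (0 : ℝ) 1, 0 < p t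
  integrableOn : ∀ ε ∈ Ioo (0 : ℝ) 1, IntegrableOn p (Icc ε 1)
  tendsto : Tendsto (fun ε : ℝ => ∫ t in ε..1, p t) (𝓝[>] 0) atTop

/-- The solution `x₁(t) = exp (k ∫_t^1 p)` of `x' = -k p x`, `x(1) = 1`. -/
def fundSol (k : ℝ) (p : ℝ → ℝ) (t : ℝ) : ℝ := Real.exp (k * ∫ s in t..1, p s)

/-- `x` is a solution on `(0,1]` of the model equation `x' = -k p x + f`: it is absolutely
continuous on every `[ε,1]`, `0 < ε < 1`, and satisfies the equation almost everywhere. -/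
def IsModelSolution (k : ℝ) (p f x : ℝ → ℝ) : Prop :=
  (∀ ε ∈ Ioo (0 : ℝ) 1, AbsolutelyContinuousOnInterval x ε 1) ∧
    ∀ᵐ t ∂(volume.restrict (Ioc (0 : ℝ) 1)), HasDerivAt x (-k * p t * x t + f t) t

/-- The space `D₊` (for `k > 0`): the solutions of the model equations `x' = -k p x + f`, `f ∈ L`,
which satisfy `x(1) = ∫_0^1 f / x₁` and are extended by `0` at `t = 0`.
Such functions are continuous on `[0,1]`, so `D₊` is given as a subset of `C[0,1]`. -/
def spaceDPlus (k : ℝ) (p : ℝ → ℝ) : Set SpaceC :=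
  {x | ∃ f : SpaceL, IsModelSolution k p f (toFun x) ∧
    toFun x 1 = ∫ s in (0 : ℝ)..1, f s / fundSol k p s ∧ toFun x 0 = 0}

/-- `x ∈ D₊` is a solution of the Cauchy problem `x' = -k p x + T x + f`, `x(0) = 0`. -/
def IsCauchySolution (k : ℝ) (p : ℝ → ℝ) (T : SpaceC →L[ℝ] SpaceL) (f : SpaceL) (x : SpaceC) :
    Prop :=
  x ∈ spaceDPlus k p ∧
    (∀ᵐ t ∂(volume.restrict (Icc (0 : ℝ) 1)),
      HasDerivAt (toFun x) (-k * p t * toFun x t + T x t + f t) t) ∧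
    toFun x 0 = 0

/-- The Cauchy problem is uniquely solvable in `D₊`: for every `f ∈ L` there is exactly one
solution in `D₊`. -/
def IsUniquelySolvable (k : ℝ) (p : ℝ → ℝ) (T : SpaceC →L[ℝ] SpaceL) : Prop :=
  ∀ f : SpaceL, ∃! x : SpaceC, IsCauchySolution k p T f x

end SingularFDE

end

noncomputable section

namespace SingularFDE

/-! The condition at `t = 1` singles out the solution `Λf(t) = ∫_0^t (x₁(t)/x₁(s)) f(s) ds` of the
model equation, so the Cauchy problem is the fixed point equation `x = Λ(Tx + f)`
(`isCauchySolution_iff`). For positive `T⁺`, `T⁻` the image of the unit ball under `T` is dominated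
by `T⁺1 + T⁻1`; hence `ΛT` is compact, and by the Fredholm alternative only the homogeneous equation
matters.

Sufficiency. Let `x = ΛTx` have maximum `M` and minimum `-m`, the maximum occurring first. Let `a₁`,
`b₁` be the masses of `T⁺1`, `T⁻1` before the maximum and `a₂`, `b₂` those between the extrema. The
kernel of `Λ` is below `1` for `s < t`, so the growth estimates are strict (`modelFun_lt_integral`):
`M < M a₁ + m b₁` and `m < m a₂ + M b₂` when `M, m > 0`. Multiplying gives `(1 - a₁)(1 - a₂) < b₁
b₂`, contrary to `b₁ b₂ ≤ (𝒯⁻)²/4 ≤ 1 - 𝒯⁺ ≤ (1 - a₁)(1 - a₂)`. This strictness is why the boundary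
values are admitted.

Necessity. Narrow bumps of mass close to `1` drive a solution to prescribed values at two points,
and rank one operators `x ↦ x(t)u` make it a homogeneous solution. As `x₁` blows up at `0`, a first
point near `0` has almost no influence at `1`, so the bound is approached. Norms are adjusted by
evaluation at `0`, which solutions do not see. -/

/-! ### Absolute continuity and almost everywhere statements -/

theorem _root_.LipschitzOnWith.comp_absolutelyContinuousOnInterval {φ f : ℝ → ℝ} {K : NNReal}
    {s : Set ℝ} {a b : ℝ} (hφ : LipschitzOnWith K φ s) (hf : AbsolutelyContinuousOnInterval f a b)
    (hs : MapsTo f (uIcc a b) s) : AbsolutelyContinuousOnInterval (φ ∘ f) a b := by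
  have h0 : Tendsto (fun E : ℕ × (ℕ → ℝ × ℝ) =>
      (K : ℝ) * ∑ i ∈ Finset.range E.1, dist (f (E.2 i).1) (f (E.2 i).2))
      (AbsolutelyContinuousOnInterval.totalLengthFilter ⊓
        𝓟 (AbsolutelyContinuousOnInterval.disjWithin a b)) (𝓝 0) := by
    simpa using Tendsto.const_mul (K : ℝ) hf
  refine squeeze_zero' (Eventually.of_forall fun E => Finset.sum_nonneg fun _ _ => dist_nonneg)
    ?_ h0
  filter_upwards [mem_inf_of_right (mem_principal_self _)] with E hE
  rw [Finset.mul_sum]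
  refine Finset.sum_le_sum fun i hi => ?_
  have := hE.1 i hi
  exact hφ.dist_le_mul _ (hs this.1) _ (hs this.2)

theorem _root_.AbsolutelyContinuousOnInterval.congr {f g : ℝ → ℝ} {a b : ℝ}
    (hf : AbsolutelyContinuousOnInterval f a b) (h : EqOn f g (uIcc a b)) :
    AbsolutelyContinuousOnInterval g a b := by
  refine Tendsto.congr' ?_ hf
  filter_upwards [mem_inf_of_right (mem_principal_self _)] with E hE
  refine Finset.sum_congr rfl fun i hi => ?_
  have := hE.1 i hi
  rw [h this.1, h this.2]

theorem ae_restrict_Ioc_of_forall_Icc {P : ℝ → Prop}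
    (h : ∀ ε ∈ Ioo (0 : ℝ) 1, ∀ᵐ t, t ∈ Icc ε 1 → P t) :
    ∀ᵐ t ∂(volume.restrict (Ioc (0 : ℝ) 1)), P t := by
  have h1 : ∀ n : ℕ, ∀ᵐ t : ℝ, t ∈ Icc ((1 : ℝ) / (n + 2)) 1 → P t := fun n =>
    h _ ⟨by positivity, by rw [div_lt_one (by positivity)]; linarith [n.cast_nonneg (α := ℝ)]⟩
  rw [ae_restrict_iff' measurableSet_Ioc]
  filter_upwards [ae_all_iff.2 h1] with t ht ht01
  obtain ⟨n, hn⟩ := exists_nat_one_div_lt ht01.1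
  refine ht n ⟨le_trans ?_ hn.le, ht01.2⟩
  exact one_div_le_one_div_of_le (by positivity) (by linarith)

variable {k : ℝ} {p f g : ℝ → ℝ}

/-! ### The fundamental solution -/

theorem IsSingularCoeff.intervalIntegrable (hp : IsSingularCoeff p) {a b : ℝ}
    (ha : a ∈ Ioc (0 : ℝ) 1) (hb : b ∈ Ioc (0 : ℝ) 1) : IntervalIntegrable p volume a b := by
  have key : ∀ a ∈ Ioc (0 : ℝ) 1, IntervalIntegrable p volume a 1 := by
    intro a ha
    rcases ha.2.eq_or_lt with rfl | h
    · exact IntervalIntegrable.refl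
    · exact (intervalIntegrable_iff_integrableOn_Icc_of_le ha.2).2 (hp.integrableOn a ⟨ha.1, h⟩)
  exact (key a ha).trans (key b hb).symm

theorem fundSol_pos (k : ℝ) (p : ℝ → ℝ) (t : ℝ) : 0 < fundSol k p t := Real.exp_pos _

theorem fundSol_one (k : ℝ) (p : ℝ → ℝ) : fundSol k p 1 = 1 := by simp [fundSol]

/-- The reciprocal of `x₁` is the integrating factor; this is why the regularity lemmas below allow
an exponent of either sign. -/
theorem fundSol_neg (k : ℝ) (p : ℝ → ℝ) (t : ℝ) : fundSol (-k) p t = (fundSol k p t)⁻¹ := by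
  simp [fundSol, Real.exp_neg]

theorem fundSol_lt (hk : 0 < k) (hp : IsSingularCoeff p) {s t : ℝ} (hs : 0 < s) (hst : s < t)
    (ht : t ≤ 1) : fundSol k p t < fundSol k p s := by
  have hs' : s ∈ Ioc (0 : ℝ) 1 := ⟨hs, hst.le.trans ht⟩
  have ht' : t ∈ Ioc (0 : ℝ) 1 := ⟨hs.trans hst, ht⟩
  have h1 : (0 : ℝ) < ∫ r in s..t, p r :=
    intervalIntegral.intervalIntegral_pos_of_pos_on (hp.intervalIntegrable hs' ht')
      (fun r hr => hp.pos r ⟨hs.trans hr.1, hr.2.le.trans ht⟩) hst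
  have h2 := intervalIntegral.integral_add_adjacent_intervals (hp.intervalIntegrable hs' ht')
    (hp.intervalIntegrable ht' ⟨one_pos, le_rfl⟩)
  unfold fundSol
  apply Real.exp_lt_exp.2
  apply mul_lt_mul_of_pos_left _ hk
  linarith

theorem fundSol_le (hk : 0 < k) (hp : IsSingularCoeff p) {s t : ℝ} (hs : 0 < s) (hst : s ≤ t)
    (ht : t ≤ 1) : fundSol k p t ≤ fundSol k p s := by
  rcases hst.eq_or_lt with rfl | h
  · exact le_rfl
  · exact (fundSol_lt hk hp hs h ht).le

theorem absolutelyContinuous_integral_right (hp : IsSingularCoeff p) {ε : ℝ}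
    (hε : ε ∈ Ioo (0 : ℝ) 1) :
    AbsolutelyContinuousOnInterval (fun t => ∫ s in t..1, p s) ε 1 := by
  have h := (hp.intervalIntegrable ⟨hε.1, hε.2.le⟩
    ⟨one_pos, le_rfl⟩).absolutelyContinuousOnInterval_intervalIntegral (c := 1) right_mem_uIcc
  refine h.neg.congr fun t _ => ?_
  simp [intervalIntegral.integral_symm t 1]

theorem absolutelyContinuous_fundSol (c : ℝ) (hp : IsSingularCoeff p) {ε : ℝ}
    (hε : ε ∈ Ioo (0 : ℝ) 1) : AbsolutelyContinuousOnInterval (fundSol c p) ε 1 := by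
  have h := (absolutelyContinuous_integral_right hp hε).const_mul c
  obtain ⟨B, hB⟩ := h.exists_bound
  have hlip : ∃ K, LipschitzOnWith K Real.exp (Icc (-B) B) :=
    (Real.contDiff_exp (n := 1)).contDiffOn.exists_lipschitzOnWith (by norm_num)
      (convex_Icc _ _) isCompact_Icc
  obtain ⟨K, hK⟩ := hlip
  exact hK.comp_absolutelyContinuousOnInterval h fun t ht => abs_le.1 (hB t ht)

theorem continuousOn_fundSol (c : ℝ) (hp : IsSingularCoeff p) :
    ContinuousOn (fundSol c p) (Ioc 0 1) := by
  intro t ht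
  have hε : t / 2 ∈ Ioo (0 : ℝ) 1 := ⟨by linarith [ht.1], by linarith [ht.1, ht.2]⟩
  have h := (absolutelyContinuous_fundSol c hp hε).continuousOn
  rw [uIcc_of_le hε.2.le] at h
  refine (h t ⟨by linarith [ht.1], ht.2⟩).mono_of_mem_nhdsWithin ?_
  rw [mem_nhdsWithin]
  exact ⟨Ioi (t / 2), isOpen_Ioi, by simp [ht.1], fun s hs => ⟨(mem_Ioi.1 hs.1).le, hs.2.2⟩⟩

theorem ae_hasDerivAt_fundSol (c : ℝ) (hp : IsSingularCoeff p) :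
    ∀ᵐ t ∂(volume.restrict (Ioc (0 : ℝ) 1)),
      HasDerivAt (fundSol c p) (-c * p t * fundSol c p t) t := by
  refine ae_restrict_Ioc_of_forall_Icc fun ε hε => ?_
  filter_upwards [(hp.intervalIntegrable ⟨hε.1, hε.2.le⟩
    ⟨one_pos, le_rfl⟩).ae_hasDerivAt_integral] with t ht hmem
  rw [uIcc_of_le hε.2.le] at ht
  have h1 : HasDerivAt (fun t => c * ∫ s in t..1, p s) (c * -p t) t := by
    have := (ht hmem 1 ⟨hε.2.le, le_rfl⟩).neg.const_mul c
    refine this.congr_of_eventuallyEq (Eventually.of_forall fun u => ?_)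
    simp [intervalIntegral.integral_symm u 1]
  refine h1.exp.congr_deriv ?_
  rw [fundSol]
  ring

theorem tendsto_fundSol (hk : 0 < k) (hp : IsSingularCoeff p) :
    Tendsto (fundSol k p) (𝓝[>] 0) atTop :=
  Real.tendsto_exp_atTop.comp (hp.tendsto.const_mul_atTop hk)

/-! ### The model equation -/

theorem intervalIntegrable_subinterval (hf : IntervalIntegrable f volume 0 1) {a b : ℝ}
    (ha : a ∈ Icc (0 : ℝ) 1) (hb : b ∈ Icc (0 : ℝ) 1) : IntervalIntegrable f volume a b :=
  hf.mono_set (uIcc_subset_uIcc (by rwa [uIcc_of_le zero_le_one]) (by rwa [uIcc_of_le zero_le_one]))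

theorem intervalIntegrable_div_fundSol (hk : 0 < k) (hp : IsSingularCoeff p)
    (hf : IntervalIntegrable f volume 0 1) :
    IntervalIntegrable (fun s => f s / fundSol k p s) volume 0 1 := by
  rw [intervalIntegrable_iff_integrableOn_Ioc_of_le zero_le_one] at hf ⊢
  have h : (fun s => f s / fundSol k p s) = fun s => f s * fundSol (-k) p s := by
    ext s; rw [fundSol_neg, div_eq_mul_inv]
  rw [h]
  refine Integrable.mul_bdd (c := 1) hf
    ((continuousOn_fundSol (-k) hp).aestronglyMeasurable measurableSet_Ioc) ?_
  refine (ae_restrict_iff' measurableSet_Ioc).2 (Eventually.of_forall fun s hs => ?_)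
  rw [fundSol_neg, Real.norm_of_nonneg (inv_nonneg.2 (fundSol_pos k p s).le)]
  apply inv_le_one_of_one_le₀
  simpa [fundSol_one] using fundSol_le hk hp hs.1 hs.2 le_rfl

theorem fundSol_div_pos (k : ℝ) (p : ℝ → ℝ) (s t : ℝ) : 0 < fundSol k p t / fundSol k p s :=
  div_pos (fundSol_pos _ _ _) (fundSol_pos _ _ _)

theorem fundSol_div_le_one (hk : 0 < k) (hp : IsSingularCoeff p) {s t : ℝ} (hs : 0 < s)
    (hst : s ≤ t) (ht : t ≤ 1) : fundSol k p t / fundSol k p s ≤ 1 :=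
  (div_le_one (fundSol_pos _ _ _)).2 (fundSol_le hk hp hs hst ht)

/-- The solution `t ↦ ∫_0^t (x₁(t) / x₁(s)) f(s) ds` of the model equation `x' = -k p x + f`. -/
def modelFun (k : ℝ) (p f : ℝ → ℝ) (t : ℝ) : ℝ :=
  fundSol k p t * ∫ s in (0 : ℝ)..t, f s / fundSol k p s

theorem modelFun_zero (k : ℝ) (p f : ℝ → ℝ) : modelFun k p f 0 = 0 := by simp [modelFun]

theorem intervalIntegrable_kernel (hk : 0 < k) (hp : IsSingularCoeff p)
    (hf : IntervalIntegrable f volume 0 1) (c : ℝ) :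
    IntervalIntegrable (fun s => fundSol k p c / fundSol k p s * f s) volume 0 1 := by
  convert (intervalIntegrable_div_fundSol hk hp hf).const_mul (fundSol k p c) using 2 with s
  ring

/-- Variation of constants between two points. The case `a = 0` is harmless: whatever positive value
`fundSol k p 0` has, it is paired with `modelFun k p f 0 = 0`. -/
theorem modelFun_eq_add (hk : 0 < k) (hp : IsSingularCoeff p)
    (hf : IntervalIntegrable f volume 0 1) {a b : ℝ} (ha : a ∈ Icc (0 : ℝ) 1)
    (hb : b ∈ Icc (0 : ℝ) 1) :
    modelFun k p f b = fundSol k p b / fundSol k p a * modelFun k p f a +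
      ∫ s in a..b, fundSol k p b / fundSol k p s * f s := by
  have hi := intervalIntegrable_div_fundSol hk hp hf
  have h0 : (0 : ℝ) ∈ Icc (0 : ℝ) 1 := ⟨le_rfl, zero_le_one⟩
  have h1 : ∫ s in a..b, fundSol k p b / fundSol k p s * f s =
      fundSol k p b * ∫ s in a..b, f s / fundSol k p s := by
    rw [← intervalIntegral.integral_const_mul]
    congr 1; ext s; ring
  have h2 := intervalIntegral.integral_add_adjacent_intervals
    (intervalIntegrable_subinterval hi h0 ha) (intervalIntegrable_subinterval hi ha hb)
  rw [h1, modelFun, modelFun, ← h2]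
  have := (fundSol_pos k p a).ne'
  field_simp

theorem kernel_integral_le (hk : 0 < k) (hp : IsSingularCoeff p)
    (hg : IntervalIntegrable g volume 0 1) (hg0 : ∀ᵐ s ∂(volume.restrict (Icc (0 : ℝ) 1)), 0 ≤ g s)
    {a b : ℝ} (ha : 0 ≤ a) (hab : a ≤ b) (hb : b ≤ 1) :
    ∫ s in a..b, fundSol k p b / fundSol k p s * g s ≤ ∫ s in a..b, g s := by
  have hsub : Ioc a b ⊆ Icc 0 1 := fun s hs => ⟨ha.trans hs.1.le, hs.2.trans hb⟩
  refine intervalIntegral.integral_mono_ae_restrict hab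
    (intervalIntegrable_subinterval (intervalIntegrable_kernel hk hp hg b) ⟨ha, hab.trans hb⟩
      ⟨ha.trans hab, hb⟩)
    (intervalIntegrable_subinterval hg ⟨ha, hab.trans hb⟩ ⟨ha.trans hab, hb⟩) ?_
  rw [EventuallyLE, ← restrict_Ioc_eq_restrict_Icc, ae_restrict_iff' measurableSet_Ioc]
  filter_upwards [(ae_restrict_iff' measurableSet_Icc).1 hg0] with s hs hsm
  exact mul_le_of_le_one_left (hs (hsub hsm))
    (fundSol_div_le_one hk hp (ha.trans_lt hsm.1) hsm.2 hb)

theorem kernel_integral_mono (hk : 0 < k) (hp : IsSingularCoeff p)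
    (hf : IntervalIntegrable f volume 0 1) (hg : IntervalIntegrable g volume 0 1)
    (hfg : ∀ᵐ s ∂(volume.restrict (Icc (0 : ℝ) 1)), f s ≤ g s)
    {a b : ℝ} (ha : 0 ≤ a) (hab : a ≤ b) (hb : b ≤ 1) (c : ℝ) :
    ∫ s in a..b, fundSol k p c / fundSol k p s * f s ≤
      ∫ s in a..b, fundSol k p c / fundSol k p s * g s := by
  have hsub : Icc a b ⊆ Icc 0 1 := fun s hs => ⟨ha.trans hs.1, hs.2.trans hb⟩
  refine intervalIntegral.integral_mono_ae_restrict hab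
    (intervalIntegrable_subinterval (intervalIntegrable_kernel hk hp hf c) ⟨ha, hab.trans hb⟩
      ⟨ha.trans hab, hb⟩)
    (intervalIntegrable_subinterval (intervalIntegrable_kernel hk hp hg c) ⟨ha, hab.trans hb⟩
      ⟨ha.trans hab, hb⟩) ?_
  filter_upwards [ae_restrict_of_ae_restrict_of_subset hsub hfg] with s hs
  exact mul_le_mul_of_nonneg_left hs (fundSol_div_pos _ _ _ _).le

theorem modelFun_eq_integral (hk : 0 < k) (hp : IsSingularCoeff p)
    (hf : IntervalIntegrable f volume 0 1) {t : ℝ} (ht : t ∈ Icc (0 : ℝ) 1) :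
    modelFun k p f t = ∫ s in (0 : ℝ)..t, fundSol k p t / fundSol k p s * f s := by
  rw [modelFun_eq_add hk hp hf ⟨le_rfl, zero_le_one⟩ ht, modelFun_zero, mul_zero, zero_add]

theorem modelFun_mono (hk : 0 < k) (hp : IsSingularCoeff p)
    (hf : IntervalIntegrable f volume 0 1) (hg : IntervalIntegrable g volume 0 1)
    (hfg : ∀ᵐ s ∂(volume.restrict (Icc (0 : ℝ) 1)), f s ≤ g s) {t : ℝ} (ht : t ∈ Icc (0 : ℝ) 1) :
    modelFun k p f t ≤ modelFun k p g t := by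
  rw [modelFun_eq_integral hk hp hf ht, modelFun_eq_integral hk hp hg ht]
  exact kernel_integral_mono hk hp hf hg hfg le_rfl ht.1 ht.2 t

theorem modelFun_neg (k : ℝ) (p f : ℝ → ℝ) (t : ℝ) :
    modelFun k p (fun s => -f s) t = -modelFun k p f t := by
  simp [modelFun, neg_div]

theorem abs_modelFun_le (hk : 0 < k) (hp : IsSingularCoeff p)
    (hf : IntervalIntegrable f volume 0 1) (hg : IntervalIntegrable g volume 0 1)
    (hfg : ∀ᵐ s ∂(volume.restrict (Icc (0 : ℝ) 1)), |f s| ≤ g s) {t : ℝ}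
    (ht : t ∈ Icc (0 : ℝ) 1) : |modelFun k p f t| ≤ modelFun k p g t := by
  rw [abs_le']
  refine ⟨modelFun_mono hk hp hf hg (hfg.mono fun s hs => (le_abs_self _).trans hs) ht, ?_⟩
  rw [← modelFun_neg]
  exact modelFun_mono hk hp hf.neg hg (hfg.mono fun s hs => (neg_le_abs _).trans hs) ht

theorem modelFun_le_integral (hk : 0 < k) (hp : IsSingularCoeff p)
    (hg : IntervalIntegrable g volume 0 1) (hg0 : ∀ᵐ s ∂(volume.restrict (Icc (0 : ℝ) 1)), 0 ≤ g s)
    {t : ℝ} (ht : t ∈ Icc (0 : ℝ) 1) : modelFun k p g t ≤ ∫ s in (0 : ℝ)..t, g s := by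
  rw [modelFun_eq_integral hk hp hg ht]
  exact kernel_integral_le hk hp hg hg0 le_rfl ht.1 ht.2

/-- An integrable majorant of the right-hand side gives a modulus of continuity of the solution. -/
theorem abs_modelFun_sub_le (hk : 0 < k) (hp : IsSingularCoeff p)
    (hf : IntervalIntegrable f volume 0 1) (hg : IntervalIntegrable g volume 0 1)
    (hfg : ∀ᵐ s ∂(volume.restrict (Icc (0 : ℝ) 1)), |f s| ≤ g s) {a b : ℝ}
    (ha : 0 ≤ a) (hab : a ≤ b) (hb : b ≤ 1) :
    |modelFun k p f b - modelFun k p f a| ≤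
      (modelFun k p g a - modelFun k p g b) + 2 * ∫ s in a..b, g s := by
  have haI : a ∈ Icc (0 : ℝ) 1 := ⟨ha, hab.trans hb⟩
  have hbI : b ∈ Icc (0 : ℝ) 1 := ⟨ha.trans hab, hb⟩
  have hg0 : ∀ᵐ s ∂(volume.restrict (Icc (0 : ℝ) 1)), 0 ≤ g s :=
    hfg.mono fun s hs => (abs_nonneg _).trans hs
  have h1 := modelFun_eq_add hk hp hf haI hbI
  have h2 := modelFun_eq_add hk hp hg haI hbI
  have h3 := kernel_integral_le hk hp hg hg0 ha hab hb
  have h4 := kernel_integral_mono hk hp hf hg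
    (hfg.mono fun s hs => (le_abs_self _).trans hs) ha hab hb b
  have h5 := kernel_integral_mono hk hp hf.neg hg
    (hfg.mono fun s hs => (neg_le_abs _).trans hs) ha hab hb b
  have h6 : ∫ s in a..b, fundSol k p b / fundSol k p s * (-f) s =
      -∫ s in a..b, fundSol k p b / fundSol k p s * f s := by simp
  have h7 := abs_modelFun_le hk hp hf hg hfg haI
  -- With `q = x₁(b)/x₁(a)`, the increment is `-(1 - q) x(a)` plus a kernel integral. The first term
  -- is controlled by the same term for the majorant, that is, by the drop of its solution plus a
  -- kernel integral. Monotonicity of `x₁` is available only on `(0,1]`, so `a = 0` is separate.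
  have h8 : |(1 - fundSol k p b / fundSol k p a) * modelFun k p f a| ≤
      (1 - fundSol k p b / fundSol k p a) * modelFun k p g a := by
    rcases ha.eq_or_lt with rfl | ha'
    · simp [modelFun_zero]
    · have := fundSol_div_le_one hk hp ha' hab hb
      rw [abs_mul, abs_of_nonneg (by linarith)]
      exact mul_le_mul_of_nonneg_left h7 (by linarith)
  rw [abs_le] at h8 ⊢
  constructor <;> linarith [h8.1, h8.2]

theorem continuousOn_modelFun (hk : 0 < k) (hp : IsSingularCoeff p)
    (hf : IntervalIntegrable f volume 0 1) : ContinuousOn (modelFun k p f) (Icc 0 1) := by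
  have hprim : ∀ {h : ℝ → ℝ}, IntervalIntegrable h volume 0 1 →
      ContinuousOn (fun t => ∫ s in (0 : ℝ)..t, h s) (Icc 0 1) := fun {h} hh => by
    simpa [uIcc_of_le] using
      intervalIntegral.continuousOn_primitive_interval' hh (a := 0) left_mem_uIcc
  intro t ht
  rcases ht.1.eq_or_lt with rfl | h0
  · have hb := (hprim hf.abs 0 ht).tendsto
    rw [intervalIntegral.integral_same] at hb
    rw [ContinuousWithinAt, modelFun_zero]
    refine squeeze_zero_norm' ?_ hb
    filter_upwards [self_mem_nhdsWithin] with s hs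
    exact (abs_modelFun_le hk hp hf hf.abs (by simp) hs).trans
      (modelFun_le_integral hk hp hf.abs (by simp) hs)
  · have hc : ContinuousWithinAt (fundSol k p) (Icc 0 1) t :=
      ((continuousOn_fundSol k hp) t ⟨h0, ht.2⟩).mono_of_mem_nhdsWithin
        (mem_nhdsWithin.2 ⟨Ioi 0, isOpen_Ioi, h0, fun s hs => ⟨hs.1, hs.2.2⟩⟩)
    exact hc.mul (hprim (intervalIntegrable_div_fundSol hk hp hf) t ht)

theorem ae_ne_of_nullSingleton (μ : Measure ℝ) [NullSingletonClass μ] (a : ℝ) : ∀ᵐ t ∂μ, t ≠ a := by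
  simp [ae_iff]

theorem IsModelSolution.congr {x y : ℝ → ℝ} (hx : IsModelSolution k p f x)
    (h : EqOn x y (Icc 0 1)) : IsModelSolution k p f y := by
  refine ⟨fun ε hε => (hx.1 ε hε).congr ?_, ?_⟩
  · rw [uIcc_of_le hε.2.le]
    exact h.mono (Icc_subset_Icc_left hε.1.le)
  -- The derivative is two-sided, and agreement on `[0,1]` says nothing to the right of `1`, so that
  -- point is discarded.
  · filter_upwards [hx.2, ae_restrict_mem measurableSet_Ioc, ae_ne_of_nullSingleton _ 1] with t ht hmem hne
    have h01 : t ∈ Ioo (0 : ℝ) 1 := ⟨hmem.1, lt_of_le_of_ne hmem.2 hne⟩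
    rw [← h ⟨hmem.1.le, hmem.2⟩]
    refine ht.congr_of_eventuallyEq ?_
    filter_upwards [Ioo_mem_nhds h01.1 h01.2] with s hs
    exact (h ⟨hs.1.le, hs.2.le⟩).symm

theorem isModelSolution_modelFun (hk : 0 < k) (hp : IsSingularCoeff p)
    (hf : IntervalIntegrable f volume 0 1) : IsModelSolution k p f (modelFun k p f) := by
  have hi := intervalIntegrable_div_fundSol hk hp hf
  refine ⟨fun ε hε => ?_, ?_⟩
  · refine (absolutelyContinuous_fundSol k hp hε).mul ?_
    refine (hi.absolutelyContinuousOnInterval_intervalIntegral (c := 0) left_mem_uIcc).mono ?_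
    rw [uIcc_of_le hε.2.le, uIcc_of_le zero_le_one]
    exact Icc_subset_Icc_left hε.1.le
  · rw [ae_restrict_iff' measurableSet_Ioc]
    filter_upwards [(ae_restrict_iff' measurableSet_Ioc).1 (ae_hasDerivAt_fundSol k hp),
      hi.ae_hasDerivAt_integral] with t h1 h2 ht
    rw [uIcc_of_le zero_le_one] at h2
    refine ((h1 ht).mul (h2 ⟨ht.1.le, ht.2⟩ 0 ⟨le_rfl, zero_le_one⟩)).congr_deriv ?_
    have := (fundSol_pos k p t).ne'
    simp only [modelFun]
    field_simp

/-- Integrating `(x/x₁)' = f/x₁` from `t` to `1` and inserting the value at `1` leaves `x(t)/x₁(t) =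
∫_0^t f/x₁`. -/
theorem IsModelSolution.eq_modelFun (hk : 0 < k) (hp : IsSingularCoeff p)
    (hf : IntervalIntegrable f volume 0 1) {x : ℝ → ℝ} (hx : IsModelSolution k p f x)
    (h1 : x 1 = ∫ s in (0 : ℝ)..1, f s / fundSol k p s) {t : ℝ} (ht : t ∈ Ioc (0 : ℝ) 1) :
    x t = modelFun k p f t := by
  rcases ht.2.eq_or_lt with rfl | ht1
  · rw [modelFun, fundSol_one, one_mul, h1]
  have hac := (hx.1 t ⟨ht.1, ht1⟩).mul (absolutelyContinuous_fundSol (-k) hp ⟨ht.1, ht1⟩)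
  have hd := hac.integral_deriv_eq_sub
  have hi := intervalIntegrable_div_fundSol hk hp hf
  have hint : ∫ s in t..1, deriv (x * fundSol (-k) p) s = ∫ s in t..1, f s / fundSol k p s := by
    refine intervalIntegral.integral_congr_ae ?_
    filter_upwards [(ae_restrict_iff' measurableSet_Ioc).1 hx.2,
      (ae_restrict_iff' measurableSet_Ioc).1 (ae_hasDerivAt_fundSol (-k) hp)] with s hs1 hs2 hs
    rw [uIoc_of_le ht.2] at hs
    have hs' : s ∈ Ioc (0 : ℝ) 1 := ⟨ht.1.trans hs.1, hs.2⟩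
    rw [((hs1 hs').mul (hs2 hs')).deriv, fundSol_neg]
    ring
  have hadd := intervalIntegral.integral_add_adjacent_intervals
    (intervalIntegrable_subinterval hi ⟨le_rfl, zero_le_one⟩ ⟨ht.1.le, ht.2⟩)
    (intervalIntegrable_subinterval hi ⟨ht.1.le, ht.2⟩ ⟨zero_le_one, le_rfl⟩)
  rw [hint] at hd
  simp only [Pi.mul_apply, fundSol_one, mul_one, fundSol_neg] at hd
  have hpos := (fundSol_pos k p t).ne'
  have : x t * (fundSol k p t)⁻¹ = ∫ s in (0 : ℝ)..t, f s / fundSol k p s := by linarith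
  rw [modelFun, ← this]
  field_simp

/-- Strict bound behind the uniqueness argument: the damping makes the growth of a solution
strictly smaller than the mass of a majorant of its right-hand side. -/
theorem modelFun_lt_integral (hk : 0 < k) (hp : IsSingularCoeff p)
    (hf : IntervalIntegrable f volume 0 1) (hg : IntervalIntegrable g volume 0 1)
    (hfg : ∀ᵐ s ∂(volume.restrict (Icc (0 : ℝ) 1)), f s ≤ g s)
    (hg0 : ∀ᵐ s ∂(volume.restrict (Icc (0 : ℝ) 1)), 0 ≤ g s) {a b : ℝ}
    (ha : 0 ≤ a) (hab : a ≤ b) (hb : b ≤ 1) (hxa : modelFun k p f a ≤ 0)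
    (hxb : 0 < modelFun k p f b) : modelFun k p f b < ∫ s in a..b, g s := by
  have haI : a ∈ Icc (0 : ℝ) 1 := ⟨ha, hab.trans hb⟩
  have hbI : b ∈ Icc (0 : ℝ) 1 := ⟨ha.trans hab, hb⟩
  have hsub : Ioc a b ⊆ Icc 0 1 := fun s hs => ⟨ha.trans hs.1.le, hs.2.trans hb⟩
  have h1 := modelFun_eq_add hk hp hf haI hbI
  have h2 := kernel_integral_mono hk hp hf hg hfg ha hab hb b
  have h3 := mul_nonpos_of_nonneg_of_nonpos (fundSol_div_pos k p a b).le hxa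
  have h4 : modelFun k p f b ≤ ∫ s in a..b, fundSol k p b / fundSol k p s * g s := by linarith
  -- Equality would make `(1 - x₁(b)/x₁(s)) g(s)` vanish almost everywhere on `(a,b]`; the first
  -- factor is positive for `s < b`, so `g = 0` there and the value at `b` could not be positive.
  refine h4.trans_lt ((kernel_integral_le hk hp hg hg0 ha hab hb).lt_of_ne fun heq => ?_)
  have hgi := intervalIntegrable_subinterval hg haI hbI
  have hki := intervalIntegrable_subinterval (intervalIntegrable_kernel hk hp hg b) haI hbI
  have hz : ∫ s in a..b, (g s - fundSol k p b / fundSol k p s * g s) = 0 := by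
    rw [intervalIntegral.integral_sub hgi hki, heq, sub_self]
  have hnn : 0 ≤ᵐ[volume.restrict (Ioc a b)]
      fun s => g s - fundSol k p b / fundSol k p s * g s := by
    rw [EventuallyLE, ae_restrict_iff' measurableSet_Ioc]
    filter_upwards [(ae_restrict_iff' measurableSet_Icc).1 hg0] with s hs hsm
    have := mul_le_of_le_one_left (hs (hsub hsm))
      (fundSol_div_le_one hk hp (ha.trans_lt hsm.1) hsm.2 hb)
    simpa using this
  rw [intervalIntegral.integral_eq_zero_iff_of_le_of_nonneg_ae hab hnn (hgi.sub hki)] at hz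
  have hz' : ∫ s in a..b, fundSol k p b / fundSol k p s * g s = ∫ s in a..b, (0 : ℝ) := by
    refine intervalIntegral.integral_congr_ae ?_
    filter_upwards [(ae_restrict_iff' measurableSet_Ioc).1 hz, ae_ne_of_nullSingleton volume b]
      with s hs hne hsm
    rw [uIoc_of_le hab] at hsm
    have h5 : fundSol k p b / fundSol k p s < 1 := (div_lt_one (fundSol_pos _ _ _)).2
      (fundSol_lt hk hp (ha.trans_lt hsm.1) (lt_of_le_of_ne hsm.2 hne) hb)
    have h6 : (1 - fundSol k p b / fundSol k p s) * g s = 0 := by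
      have := hs hsm
      simp only [Pi.zero_apply] at this
      linarith
    rcases mul_eq_zero.1 h6 with h | h
    · linarith
    · rw [h, mul_zero]
  rw [intervalIntegral.integral_zero] at hz'
  linarith

/-! ### The solution operator and the fixed point equation -/

theorem intervalIntegrable_coe (f : SpaceL) : IntervalIntegrable f volume 0 1 :=
  (intervalIntegrable_iff_integrableOn_Icc_of_le zero_le_one).2 (L1.integrable_coeFn f)

theorem norm_eq_intervalIntegral (f : SpaceL) : ‖f‖ = ∫ s in (0 : ℝ)..1, |f s| := by
  rw [L1.norm_eq_integral_norm, intervalIntegral.integral_of_le zero_le_one,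
    ← integral_Icc_eq_integral_Ioc]
  simp only [Real.norm_eq_abs]

theorem modelFun_congr_ae (hfg : ∀ᵐ s ∂(volume.restrict (Icc (0 : ℝ) 1)), f s = g s) {t : ℝ}
    (ht : t ∈ Icc (0 : ℝ) 1) : modelFun k p f t = modelFun k p g t := by
  rw [modelFun, modelFun]
  congr 1
  refine intervalIntegral.integral_congr_ae ?_
  filter_upwards [(ae_restrict_iff' measurableSet_Icc).1 hfg] with s hs hsm
  rw [uIoc_of_le ht.1] at hsm
  rw [hs ⟨hsm.1.le, hsm.2.trans ht.2⟩]

theorem modelFun_add (hk : 0 < k) (hp : IsSingularCoeff p)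
    (hf : IntervalIntegrable f volume 0 1) (hg : IntervalIntegrable g volume 0 1) {t : ℝ}
    (ht : t ∈ Icc (0 : ℝ) 1) :
    modelFun k p (fun s => f s + g s) t = modelFun k p f t + modelFun k p g t := by
  have h0 : (0 : ℝ) ∈ Icc (0 : ℝ) 1 := ⟨le_rfl, zero_le_one⟩
  simp only [modelFun, add_div]
  rw [intervalIntegral.integral_add
    (intervalIntegrable_subinterval (intervalIntegrable_div_fundSol hk hp hf) h0 ht)
    (intervalIntegrable_subinterval (intervalIntegrable_div_fundSol hk hp hg) h0 ht), mul_add]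

theorem modelFun_const_mul (c t : ℝ) :
    modelFun k p (fun s => c * f s) t = c * modelFun k p f t := by
  simp only [modelFun, mul_div_assoc, intervalIntegral.integral_const_mul]
  ring

theorem abs_modelFun_le_integral (hk : 0 < k) (hp : IsSingularCoeff p)
    (hf : IntervalIntegrable f volume 0 1) {t : ℝ} (ht : t ∈ Icc (0 : ℝ) 1) :
    |modelFun k p f t| ≤ ∫ s in (0 : ℝ)..1, |f s| := by
  refine (abs_modelFun_le hk hp hf hf.abs (by simp) ht).trans
    ((modelFun_le_integral hk hp hf.abs (by simp) ht).trans ?_)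
  exact intervalIntegral.integral_mono_interval le_rfl ht.1 ht.2
    (Eventually.of_forall fun s => abs_nonneg _) hf.abs

/-- The solution operator `L → C` of the model equation with the conditions defining `D₊`. -/
def solOp (hk : 0 < k) (hp : IsSingularCoeff p) : SpaceL →L[ℝ] SpaceC :=
  LinearMap.mkContinuous
    { toFun := fun f => ⟨fun t : Icc (0 : ℝ) 1 => modelFun k p f t,
        (continuousOn_modelFun hk hp (intervalIntegrable_coe f)).domRestrict⟩
      map_add' := fun f g => by
        ext t
        have h := modelFun_congr_ae (k := k) (p := p) (g := fun s => f s + g s)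
          (Lp.coeFn_add f g) t.2
        exact h.trans
          (modelFun_add hk hp (intervalIntegrable_coe f) (intervalIntegrable_coe g) t.2)
      map_smul' := fun c f => by
        ext t
        have h := modelFun_congr_ae (k := k) (p := p) (g := fun s => c * f s)
          (Lp.coeFn_smul c f) t.2
        exact h.trans (modelFun_const_mul c t) }
    1 (fun f => by
      rw [one_mul, ContinuousMap.norm_le _ (norm_nonneg _)]
      intro t
      rw [norm_eq_intervalIntegral]
      exact abs_modelFun_le_integral hk hp (intervalIntegrable_coe f) t.2)

theorem solOp_apply (hk : 0 < k) (hp : IsSingularCoeff p) (f : SpaceL) (t : Icc (0 : ℝ) 1) :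
    solOp hk hp f t = modelFun k p f t := rfl

theorem toFun_of_mem (x : SpaceC) {t : ℝ} (ht : t ∈ Icc (0 : ℝ) 1) : toFun x t = x ⟨t, ht⟩ :=
  IccExtend_of_mem _ _ ht

theorem ae_restrict_Icc_iff {P : ℝ → Prop} :
    (∀ᵐ t ∂(volume.restrict (Icc (0 : ℝ) 1)), P t) ↔
      ∀ᵐ t ∂(volume.restrict (Ioc (0 : ℝ) 1)), P t := by
  rw [restrict_Ioc_eq_restrict_Icc]

/-- The Cauchy problem in `D₊` is the fixed point equation `x = Λ (T x + f)`, `Λ` the solution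
operator of the model equation. -/
theorem isCauchySolution_iff (hk : 0 < k) (hp : IsSingularCoeff p) (T : SpaceC →L[ℝ] SpaceL)
    (f : SpaceL) (x : SpaceC) :
    IsCauchySolution k p T f x ↔ x = solOp hk hp (T x + f) := by
  constructor
  · rintro ⟨⟨g, hg, hg1, hg0⟩, hd, -⟩
    have hxg : x = solOp hk hp g := by
      ext t
      rw [solOp_apply, ← IccExtend_val (zero_le_one (α := ℝ)) x t]
      rcases t.2.1.eq_or_lt with h | h
      · rw [← h, modelFun_zero]
        exact hg0
      · exact hg.eq_modelFun hk hp (intervalIntegrable_coe g) hg1 ⟨h, t.2.2⟩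
    have hgT : g = T x + f := by
      apply Lp.ext
      filter_upwards [hd, ae_restrict_Icc_iff.2 hg.2, Lp.coeFn_add (T x) f] with t h1 h2 h3
      have := h1.unique h2
      rw [h3, Pi.add_apply]
      linarith
    rw [← hgT]
    exact hxg
  · intro hx
    have heq : EqOn (modelFun k p (T x + f : SpaceL)) (toFun x) (Icc 0 1) := fun t ht => by
      rw [toFun_of_mem x ht, hx, solOp_apply, ← hx]
    have hms := (isModelSolution_modelFun hk hp (intervalIntegrable_coe (T x + f))).congr heq
    have h0 : toFun x 0 = 0 := by
      rw [← heq ⟨le_rfl, zero_le_one⟩, modelFun_zero]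
    refine ⟨⟨T x + f, hms, ?_, h0⟩, ?_, h0⟩
    · rw [← heq ⟨zero_le_one, le_rfl⟩, modelFun, fundSol_one, one_mul]
    · filter_upwards [ae_restrict_Icc_iff.2 hms.2, Lp.coeFn_add (T x) f] with t h1 h2
      rw [h2, Pi.add_apply, ← add_assoc] at h1
      exact h1

/-! ### Compactness and the Fredholm alternative -/

/-- Arzelà–Ascoli: the constraints are closed under pointwise limits and force continuity, so the
set is compact for pointwise convergence by Tychonoff, and `ω` makes it equicontinuous. -/
theorem isCompact_of_modulus {X : Type*} [TopologicalSpace X] (ω : X → X → ℝ)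
    (hω : ∀ t, Tendsto (ω t) (𝓝 t) (𝓝 0)) (B : ℝ) :
    IsCompact {x : C(X, ℝ) | (∀ t, |x t| ≤ B) ∧ ∀ t s, |x s - x t| ≤ ω t s} := by
  refine ArzelaAscoli.isCompact_of_equicontinuous _ ?_ ?_
  · have hcont : ∀ y : X → ℝ, (∀ t s, |y s - y t| ≤ ω t s) → Continuous y := fun y hy =>
      continuous_iff_continuousAt.2 fun t => by
        rw [ContinuousAt, tendsto_iff_dist_tendsto_zero]
        exact squeeze_zero (fun _ => dist_nonneg) (fun s => hy t s) (hω t)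
    have himg : ContinuousMap.toFun '' {x : C(X, ℝ) | (∀ t, |x t| ≤ B) ∧
        ∀ t s, |x s - x t| ≤ ω t s} =
        (univ.pi fun _ => Icc (-B) B) ∩ {y : X → ℝ | ∀ t s, |y s - y t| ≤ ω t s} := by
      ext y
      constructor
      · rintro ⟨x, hx, rfl⟩
        exact ⟨fun t _ => abs_le.1 (hx.1 t), hx.2⟩
      · rintro ⟨h1, h2⟩
        exact ⟨⟨y, hcont y h2⟩, ⟨fun t => abs_le.2 (h1 t trivial), h2⟩, rfl⟩
    rw [himg]
    refine (isCompact_univ_pi fun _ => isCompact_Icc).inter_right ?_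
    simp only [ofPred_forall]
    refine isClosed_iInter fun t => isClosed_iInter fun s => isClosed_le (by fun_prop) (by fun_prop)
  · intro t
    rw [Metric.equicontinuousAt_iff_right]
    intro ε hε
    filter_upwards [(hω t).eventually (gt_mem_nhds hε)] with s hs x
    rw [dist_comm]
    exact (x.2.2 t s).trans_lt hs

/-- An operator `C → L` whose image of the unit ball has an integrable majorant becomes compact
after composition with the solution operator. -/
theorem isCompactOperator_solOp_comp (hk : 0 < k) (hp : IsSingularCoeff p)
    (T : SpaceC →L[ℝ] SpaceL) (g : SpaceL)
    (hT : ∀ x : SpaceC, ‖x‖ ≤ 1 → ∀ᵐ t ∂(volume.restrict (Icc (0 : ℝ) 1)), |T x t| ≤ g t) :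
    IsCompactOperator ((solOp hk hp).comp T) := by
  set h : SpaceC := solOp hk hp g
  have hgi := intervalIntegrable_coe g
  have hG : ContinuousOn (fun t => ∫ s in (0 : ℝ)..t, g s) (Icc 0 1) := by
    simpa [uIcc_of_le] using
      intervalIntegral.continuousOn_primitive_interval' hgi (a := 0) left_mem_uIcc
  have hG' : Continuous fun t : Icc (0 : ℝ) 1 => ∫ s in (0 : ℝ)..t, g s := hG.domRestrict
  have hK := isCompact_of_modulus (fun t s : Icc (0 : ℝ) 1 => |h s - h t| +
    2 * |(∫ r in (0 : ℝ)..s, g r) - ∫ r in (0 : ℝ)..t, g r|) (fun t => by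
      have : Continuous fun s : Icc (0 : ℝ) 1 => |h s - h t| +
          2 * |(∫ r in (0 : ℝ)..s, g r) - ∫ r in (0 : ℝ)..t, g r| := by fun_prop
      simpa using this.tendsto t) ‖h‖
  refine (isCompactOperator_iff_image_closedBall_subset_compact
    ((solOp hk hp).comp T : SpaceC →ₗ[ℝ] SpaceC) one_pos).2 ⟨_, hK, ?_⟩
  rintro _ ⟨x, hx, rfl⟩
  have hfg := hT x (by simpa using hx)
  have hfi := intervalIntegrable_coe (T x)
  have hord : ∀ t s : Icc (0 : ℝ) 1, t ≤ s → |solOp hk hp (T x) s - solOp hk hp (T x) t| ≤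
      |h s - h t| + 2 * |(∫ r in (0 : ℝ)..s, g r) - ∫ r in (0 : ℝ)..t, g r| := by
    intro t s hts
    refine (abs_modelFun_sub_le hk hp hfi hgi hfg t.2.1 hts s.2.2).trans ?_
    have h0 : (0 : ℝ) ∈ Icc (0 : ℝ) 1 := ⟨le_rfl, zero_le_one⟩
    rw [← intervalIntegral.integral_interval_sub_left (intervalIntegrable_subinterval hgi h0 s.2)
      (intervalIntegrable_subinterval hgi h0 t.2), abs_sub_comm (h s)]
    gcongr
    · exact le_abs_self _
    · exact le_abs_self _
  refine ⟨fun t => ?_, fun t s => ?_⟩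
  · exact (abs_modelFun_le hk hp hfi hgi hfg t.2).trans
      ((le_abs_self _).trans (h.norm_coe_le_norm t))
  · rcases le_total t s with hts | hts
    · exact hord t s hts
    · have := hord s t hts
      rw [abs_sub_comm, abs_sub_comm (h t), abs_sub_comm (∫ r in (0 : ℝ)..t, g r)] at this
      exact this

/-- Fredholm alternative for the Cauchy problem. -/
theorem isUniquelySolvable_of_homogeneous (hk : 0 < k) (hp : IsSingularCoeff p)
    (T : SpaceC →L[ℝ] SpaceL) (hc : IsCompactOperator ((solOp hk hp).comp T))
    (h0 : ∀ x : SpaceC, x = solOp hk hp (T x) → x = 0) : IsUniquelySolvable k p T := by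
  -- For a compact operator `1` is an eigenvalue or a resolvent point; an eigenvector would be a
  -- nonzero homogeneous solution.
  have hres := (hc.hasEigenvalue_or_mem_resolventSet (one_ne_zero (α := ℝ))).resolve_left
    fun hev => by
      obtain ⟨x, hx⟩ := hev.exists_hasEigenvector
      have h1 := hx.apply_eq_smul
      rw [one_smul] at h1
      exact hx.2 (h0 x h1.symm)
  rw [spectrum.mem_resolventSet_iff, map_one, ContinuousLinearMap.isUnit_iff_bijective] at hres
  intro f
  obtain ⟨x, hx, hux⟩ := hres.existsUnique (solOp hk hp f)
  have hiff : ∀ y : SpaceC, IsCauchySolution k p T f y ↔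
      (1 - (solOp hk hp).comp T) y = solOp hk hp f := fun y => by
    rw [isCauchySolution_iff hk hp, map_add]
    change _ ↔ y - solOp hk hp (T y) = _
    rw [sub_eq_iff_eq_add']
  exact ⟨x, (hiff x).2 hx, fun y hy => hux y ((hiff y).1 hy)⟩

/-! ### Positive operators and their norms -/

theorem IsPositiveOp.ae_mono {T : SpaceC →L[ℝ] SpaceL} (hT : IsPositiveOp T) {x y : SpaceC}
    (h : ∀ t, x t ≤ y t) : ∀ᵐ t ∂(volume.restrict (Icc (0 : ℝ) 1)), T x t ≤ T y t := by
  have h1 := hT (y - x) fun t => by simpa using h t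
  rw [map_sub] at h1
  filter_upwards [h1, Lp.coeFn_sub (T y) (T x)] with t h2 h3
  rw [h3, Pi.sub_apply] at h2
  linarith

theorem ae_map_const (T : SpaceC →L[ℝ] SpaceL) (c : ℝ) :
    ∀ᵐ t ∂(volume.restrict (Icc (0 : ℝ) 1)), T (c • 1) t = c * T 1 t := by
  rw [map_smul]
  filter_upwards [Lp.coeFn_smul c (T 1)] with t ht
  simpa using ht

theorem IsPositiveOp.ae_le_const_mul {T : SpaceC →L[ℝ] SpaceL} (hT : IsPositiveOp T) {x : SpaceC}
    {c : ℝ} (h : ∀ t, x t ≤ c) :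
    ∀ᵐ t ∂(volume.restrict (Icc (0 : ℝ) 1)), T x t ≤ c * T 1 t := by
  filter_upwards [hT.ae_mono (x := x) (y := c • 1) (by simpa using h), ae_map_const T c]
    with t h1 h2
  rwa [h2] at h1

theorem IsPositiveOp.ae_const_mul_le {T : SpaceC →L[ℝ] SpaceL} (hT : IsPositiveOp T) {x : SpaceC}
    {c : ℝ} (h : ∀ t, c ≤ x t) :
    ∀ᵐ t ∂(volume.restrict (Icc (0 : ℝ) 1)), c * T 1 t ≤ T x t := by
  filter_upwards [hT.ae_mono (x := c • 1) (y := x) (by simpa using h), ae_map_const T c]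
    with t h1 h2
  rwa [h2] at h1

theorem IsPositiveOp.ae_one_nonneg {T : SpaceC →L[ℝ] SpaceL} (hT : IsPositiveOp T) :
    ∀ᵐ t ∂(volume.restrict (Icc (0 : ℝ) 1)), 0 ≤ T 1 t := hT 1 fun _ => by simp

theorem IsPositiveOp.ae_abs_le {T : SpaceC →L[ℝ] SpaceL} (hT : IsPositiveOp T) (x : SpaceC) :
    ∀ᵐ t ∂(volume.restrict (Icc (0 : ℝ) 1)), |T x t| ≤ ‖x‖ * T 1 t := by
  filter_upwards [hT.ae_le_const_mul (x := x) fun t => (le_abs_self _).trans (x.norm_coe_le_norm t),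
    hT.ae_const_mul_le (x := x) fun t => neg_le_of_abs_le (x.norm_coe_le_norm t)] with t h1 h2
  exact abs_le.2 ⟨by linarith, h1⟩

theorem IsPositiveOp.norm_eq {T : SpaceC →L[ℝ] SpaceL} (hT : IsPositiveOp T) : ‖T‖ = ‖T 1‖ := by
  refine le_antisymm (T.opNorm_le_bound (norm_nonneg _) fun x => ?_) ?_
  · rw [mul_comm, ← norm_norm x, ← norm_smul]
    refine Lp.norm_le_norm_of_ae_le ?_
    filter_upwards [hT.ae_abs_le x, Lp.coeFn_smul ‖x‖ (T 1)] with t h1 h2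
    rw [h2]
    exact h1.trans (le_abs_self _)
  · simpa using T.le_opNorm 1

theorem IsPositiveOp.norm_eq_integral {T : SpaceC →L[ℝ] SpaceL} (hT : IsPositiveOp T) :
    ‖T‖ = ∫ s in (0 : ℝ)..1, T 1 s := by
  rw [hT.norm_eq, norm_eq_intervalIntegral]
  refine intervalIntegral.integral_congr_ae ?_
  filter_upwards [(ae_restrict_iff' measurableSet_Icc).1 hT.ae_one_nonneg] with s hs hsm
  rw [uIoc_of_le zero_le_one] at hsm
  exact abs_of_nonneg (hs ⟨hsm.1.le, hsm.2⟩)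

theorem ae_sub_apply (Tp Tm : SpaceC →L[ℝ] SpaceL) (x : SpaceC) :
    ∀ᵐ t ∂(volume.restrict (Icc (0 : ℝ) 1)), (Tp - Tm) x t = Tp x t - Tm x t :=
  Lp.coeFn_sub (Tp x) (Tm x)

theorem isCompactOperator_solOp_comp_sub (hk : 0 < k) (hp : IsSingularCoeff p)
    {Tp Tm : SpaceC →L[ℝ] SpaceL} (hTp : IsPositiveOp Tp) (hTm : IsPositiveOp Tm) :
    IsCompactOperator ((solOp hk hp).comp (Tp - Tm)) := by
  refine isCompactOperator_solOp_comp hk hp _ (Tp 1 + Tm 1) fun x hx => ?_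
  filter_upwards [hTp.ae_abs_le x, hTm.ae_abs_le x, ae_sub_apply Tp Tm x,
    Lp.coeFn_add (Tp 1) (Tm 1), hTp.ae_one_nonneg, hTm.ae_one_nonneg] with t h1 h2 h3 h4 h5 h6
  rw [h3, h4, Pi.add_apply]
  have h7 := mul_le_of_le_one_left h5 hx
  have h8 := mul_le_of_le_one_left h6 hx
  have := abs_sub (Tp x t) (Tm x t)
  linarith

/-! ### Sufficiency: the homogeneous equation -/

/-- `a, b` are the masses of the two operators before the first and between the two extrema. -/
theorem not_extremal_inequalities {a₁ a₂ b₁ b₂ τp τm M m : ℝ} (ha₁ : 0 ≤ a₁) (ha₂ : 0 ≤ a₂)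
    (hb₁ : 0 ≤ b₁) (hb₂ : 0 ≤ b₂) (hp : a₁ + a₂ ≤ τp) (hm : b₁ + b₂ ≤ τm) (h1 : τp ≤ 1)
    (h2 : τm ≤ 2 * √(1 - τp)) (hM : 0 < M) (hm0 : 0 < m)
    (hM' : M < M * a₁ + m * b₁) (hm' : m < m * a₂ + M * b₂) : False := by
  have hprod : (M * (1 - a₁)) * (m * (1 - a₂)) < (m * b₁) * (M * b₂) :=
    mul_lt_mul'' (by linarith) (by linarith) (mul_nonneg hM.le (by linarith))
      (mul_nonneg hm0.le (by linarith))
  have hlt : (1 - a₁) * (1 - a₂) < b₁ * b₂ := by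
    refine lt_of_mul_lt_mul_left ?_ (mul_pos hM hm0).le
    linarith
  have hsq : τm ^ 2 ≤ 4 * (1 - τp) := by
    have := pow_le_pow_left₀ (by linarith) h2 2
    rwa [mul_pow, Real.sq_sqrt (by linarith), show (2 : ℝ) ^ 2 = 4 by norm_num] at this
  have h3 : (b₁ + b₂) ^ 2 ≤ τm ^ 2 := pow_le_pow_left₀ (by linarith) hm 2
  -- The chain is `4 b₁ b₂ ≤ (b₁ + b₂)² ≤ 4(1 - τp) ≤ 4(1 - a₁ - a₂) ≤ 4(1 - a₁)(1 - a₂)`.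
  nlinarith [sq_nonneg (b₁ - b₂), mul_nonneg ha₁ ha₂]

/-- Uniqueness when the maximum `M` is attained before the minimum `-m`; `f` is the value of the
difference of two positive operators, `u` and `v` are their values at the constant `1`. -/
theorem extrema_eq_zero (hk : 0 < k) (hp : IsSingularCoeff p) {f u v : ℝ → ℝ} {τp τm M m : ℝ}
    (hf : IntervalIntegrable f volume 0 1) (hu : IntervalIntegrable u volume 0 1)
    (hv : IntervalIntegrable v volume 0 1)
    (hu0 : ∀ᵐ t ∂(volume.restrict (Icc (0 : ℝ) 1)), 0 ≤ u t)
    (hv0 : ∀ᵐ t ∂(volume.restrict (Icc (0 : ℝ) 1)), 0 ≤ v t)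
    (hfu : ∀ᵐ t ∂(volume.restrict (Icc (0 : ℝ) 1)), f t ≤ M * u t + m * v t)
    (hfl : ∀ᵐ t ∂(volume.restrict (Icc (0 : ℝ) 1)), -f t ≤ m * u t + M * v t)
    (hup : ∫ t in (0 : ℝ)..1, u t ≤ τp) (hvm : ∫ t in (0 : ℝ)..1, v t ≤ τm)
    (h1 : τp ≤ 1) (h2 : τm ≤ 2 * √(1 - τp)) (hM : 0 ≤ M) (hm : 0 ≤ m) {a b : ℝ} (ha : 0 ≤ a)
    (hab : a ≤ b) (hb : b ≤ 1) (hMa : modelFun k p f a = M) (hmb : modelFun k p f b = -m) :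
    M = 0 ∧ m = 0 := by
  have hI : ∀ c d : ℝ, IntervalIntegrable (fun t => c * u t + d * v t) volume 0 1 := fun c d =>
    (hu.const_mul c).add (hv.const_mul d)
  have h0I : (0 : ℝ) ∈ Icc (0 : ℝ) 1 := ⟨le_rfl, zero_le_one⟩
  have h1I : (1 : ℝ) ∈ Icc (0 : ℝ) 1 := ⟨zero_le_one, le_rfl⟩
  have haI : a ∈ Icc (0 : ℝ) 1 := ⟨ha, hab.trans hb⟩
  have hbI : b ∈ Icc (0 : ℝ) 1 := ⟨ha.trans hab, hb⟩
  have hsplit : ∀ (c d : ℝ) {r s : ℝ}, r ∈ Icc (0 : ℝ) 1 → s ∈ Icc (0 : ℝ) 1 →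
      ∫ t in r..s, (c * u t + d * v t) = c * (∫ t in r..s, u t) + d * ∫ t in r..s, v t := by
    intro c d r s hr hs
    rw [intervalIntegral.integral_add
      ((intervalIntegrable_subinterval hu hr hs).const_mul c)
      ((intervalIntegrable_subinterval hv hr hs).const_mul d),
      intervalIntegral.integral_const_mul, intervalIntegral.integral_const_mul]
  have hnn : ∀ {w : ℝ → ℝ}, (∀ᵐ t ∂(volume.restrict (Icc (0 : ℝ) 1)), 0 ≤ w t) → ∀ {r s : ℝ},
      0 ≤ r → r ≤ s → s ≤ 1 → 0 ≤ ∫ t in r..s, w t := fun {w} hw {r s} hr hrs hs =>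
    intervalIntegral.integral_nonneg_of_ae_restrict hrs
      (ae_restrict_of_ae_restrict_of_subset (Icc_subset_Icc hr hs) hw)
  have hle : ∀ {w : ℝ → ℝ}, IntervalIntegrable w volume 0 1 →
      (∀ᵐ t ∂(volume.restrict (Icc (0 : ℝ) 1)), 0 ≤ w t) →
      (∫ t in (0 : ℝ)..a, w t) + (∫ t in a..b, w t) ≤ ∫ t in (0 : ℝ)..1, w t := by
    intro w hw hw0
    rw [intervalIntegral.integral_add_adjacent_intervals (intervalIntegrable_subinterval hw h0I haI)
      (intervalIntegrable_subinterval hw haI hbI),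
      ← intervalIntegral.integral_add_adjacent_intervals (intervalIntegrable_subinterval hw h0I hbI)
      (intervalIntegrable_subinterval hw hbI h1I)]
    linarith [hnn hw0 hbI.1 hb le_rfl]
  have hcomb : ∀ {c d : ℝ}, 0 ≤ c → 0 ≤ d →
      ∀ᵐ t ∂(volume.restrict (Icc (0 : ℝ) 1)), 0 ≤ c * u t + d * v t := fun hc hd => by
    filter_upwards [hu0, hv0] with t h3 h4
    positivity
  have hup' := hle hu hu0
  have hvm' := hle hv hv0
  have ha1 := hnn hu0 le_rfl ha haI.2
  have ha2 := hnn hu0 ha hab hb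
  have hb1 := hnn hv0 le_rfl ha haI.2
  have hb2 := hnn hv0 ha hab hb
  have hmax : 0 < M → M < M * (∫ t in (0 : ℝ)..a, u t) + m * ∫ t in (0 : ℝ)..a, v t := fun hM0 => by
    have := modelFun_lt_integral hk hp hf (hI M m) hfu (hcomb hM hm) le_rfl ha haI.2
      (modelFun_zero k p f).le (hMa ▸ hM0)
    rwa [hMa, hsplit _ _ h0I haI] at this
  have hmin : 0 < m → m < m * (∫ t in a..b, u t) + M * ∫ t in a..b, v t := fun hm0 => by
    have := modelFun_lt_integral hk hp hf.neg (hI m M) hfl (hcomb hm hM) ha hab hb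
      ((modelFun_neg k p f a).trans_le (by linarith))
      (lt_of_lt_of_eq hm0 (by rw [← neg_neg m, ← hmb]; exact (modelFun_neg k p f b).symm))
    rw [hsplit _ _ haI hbI] at this
    refine lt_of_eq_of_lt ?_ this
    rw [← neg_neg m, ← hmb]
    exact (modelFun_neg k p f b).symm
  -- If only one of `M`, `m` is positive, its inequality reads `M < M a₁` or `m < m a₂`, impossible
  -- since the mass of `u` is at most `1`.
  rcases hM.eq_or_lt with rfl | hM0
  · refine ⟨rfl, ?_⟩
    by_contra hne
    have hm0 := lt_of_le_of_ne hm (Ne.symm hne)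
    nlinarith [hmin hm0]
  · exfalso
    rcases hm.eq_or_lt with rfl | hm0
    · nlinarith [hmax hM0]
    · exact not_extremal_inequalities ha1 ha2 hb1 hb2 (hup'.trans hup) (hvm'.trans hvm) h1 h2
        hM0 hm0 (hmax hM0) (hmin hm0)

theorem eq_zero_of_homogeneous (hk : 0 < k) (hp : IsSingularCoeff p) {τp τm : ℝ}
    {Tp Tm : SpaceC →L[ℝ] SpaceL} (hTp : IsPositiveOp Tp) (hTm : IsPositiveOp Tm)
    (hp1 : ‖Tp‖ ≤ τp) (hm1 : ‖Tm‖ ≤ τm) (h1 : τp ≤ 1) (h2 : τm ≤ 2 * √(1 - τp)) {x : SpaceC}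
    (hx : x = solOp hk hp ((Tp - Tm) x)) : x = 0 := by
  obtain ⟨t₁, -, ht₁⟩ := isCompact_univ.exists_isMaxOn (univ_nonempty) x.continuous.continuousOn
  obtain ⟨t₂, -, ht₂⟩ := isCompact_univ.exists_isMinOn (univ_nonempty) x.continuous.continuousOn
  have hmax : ∀ t, x t ≤ x t₁ := fun t => ht₁ (mem_univ t)
  have hmin : ∀ t, x t₂ ≤ x t := fun t => ht₂ (mem_univ t)
  have hval : ∀ t : Icc (0 : ℝ) 1, x t = modelFun k p ((Tp - Tm) x) t := fun t => by
    conv_lhs => rw [hx]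
    rfl
  have hx0 : x ⟨0, le_rfl, zero_le_one⟩ = 0 := by rw [hval, modelFun_zero]
  have hM : 0 ≤ x t₁ := hx0.ge.trans (hmax _)
  have hm : 0 ≤ -x t₂ := by linarith [hmin ⟨0, le_rfl, zero_le_one⟩]
  have hfu : ∀ᵐ t ∂(volume.restrict (Icc (0 : ℝ) 1)),
      (Tp - Tm) x t ≤ x t₁ * Tp 1 t + -x t₂ * Tm 1 t := by
    filter_upwards [ae_sub_apply Tp Tm x, hTp.ae_le_const_mul hmax, hTm.ae_const_mul_le hmin]
      with t h3 h4 h5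
    linarith
  have hfl : ∀ᵐ t ∂(volume.restrict (Icc (0 : ℝ) 1)),
      -(Tp - Tm) x t ≤ -x t₂ * Tp 1 t + x t₁ * Tm 1 t := by
    filter_upwards [ae_sub_apply Tp Tm x, hTp.ae_const_mul_le hmin, hTm.ae_le_const_mul hmax]
      with t h3 h4 h5
    linarith
  have hf := intervalIntegrable_coe ((Tp - Tm) x)
  rw [hTp.norm_eq_integral] at hp1
  rw [hTm.norm_eq_integral] at hm1
  have hzero : x t₁ = 0 ∧ x t₂ = 0 := by
    rcases le_total t₁ t₂ with h | h
    · have := extrema_eq_zero hk hp hf (intervalIntegrable_coe (Tp 1)) (intervalIntegrable_coe (Tm 1))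
        hTp.ae_one_nonneg hTm.ae_one_nonneg hfu hfl hp1 hm1 h1 h2 hM hm t₁.2.1 h t₂.2.2
        (hval t₁).symm (by rw [← hval, neg_neg])
      exact ⟨this.1, neg_eq_zero.1 this.2⟩
    -- When the minimum comes first, the argument applies to `-x` with `M` and `m` exchanged.
    · have := extrema_eq_zero hk hp hf.neg (intervalIntegrable_coe (Tp 1))
        (intervalIntegrable_coe (Tm 1)) hTp.ae_one_nonneg hTm.ae_one_nonneg hfl
        (by simpa using hfu) hp1 hm1 h1 h2 hm hM t₂.2.1 h t₁.2.2
        ((modelFun_neg k p _ _).trans (by rw [← hval])) ((modelFun_neg k p _ _).trans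
          (by rw [← hval]))
      exact ⟨this.2, neg_eq_zero.1 this.1⟩
  ext t
  exact le_antisymm ((hmax t).trans hzero.1.le) (hzero.2.ge.trans (hmin t))

/-! ### Bumps of nearly unit mass -/

/-- A right-hand side supported in `[a, b]` whose model solution takes the value `1` at `b`. -/
def bumpFun (k : ℝ) (p : ℝ → ℝ) (a b : ℝ) : ℝ → ℝ :=
  (Ioc a b).indicator fun s => fundSol k p s / (fundSol k p b * (b - a))

theorem bumpFun_nonneg (k : ℝ) (p : ℝ → ℝ) (a b s : ℝ) : 0 ≤ bumpFun k p a b s :=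
  indicator_nonneg (fun r hr => div_nonneg (fundSol_pos _ _ _).le
    (mul_nonneg (fundSol_pos _ _ _).le (by linarith [hr.1, hr.2]))) s

theorem bumpFun_le (hk : 0 < k) (hp : IsSingularCoeff p) {a b : ℝ} (ha : 0 < a) (hab : a < b)
    (hb : b ≤ 1) (s : ℝ) :
    bumpFun k p a b s ≤ (Ioc a b).indicator
      (fun _ => fundSol k p a / (fundSol k p b * (b - a))) s := by
  refine indicator_le_indicator' fun hs => ?_
  have := fundSol_pos k p b
  have h2 := sub_pos.2 hab
  have := fundSol_le hk hp ha hs.1.le (hs.2.trans hb)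
  gcongr

theorem integrable_bumpFun (k : ℝ) (hp : IsSingularCoeff p) {a b : ℝ} (ha : 0 < a) (hb : b ≤ 1) :
    Integrable (bumpFun k p a b) := by
  rw [bumpFun, integrable_indicator_iff measurableSet_Ioc]
  refine (ContinuousOn.integrableOn_Icc ?_).mono_set Ioc_subset_Icc_self
  exact ((continuousOn_fundSol k hp).mono fun s hs => ⟨ha.trans_le hs.1, hs.2.trans hb⟩).div_const _

theorem bumpFun_div_fundSol (k : ℝ) (p : ℝ → ℝ) (a b s : ℝ) :
    bumpFun k p a b s / fundSol k p s =
      (Ioc a b).indicator (fun _ => (fundSol k p b * (b - a))⁻¹) s := by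
  by_cases hs : s ∈ Ioc a b
  · have := (fundSol_pos k p s).ne'
    simp only [bumpFun, indicator_of_mem hs]
    field_simp
  · simp [bumpFun, indicator_of_notMem hs]

theorem modelFun_bumpFun_of_le (k : ℝ) (p : ℝ → ℝ) {a b t : ℝ} (ht0 : 0 ≤ t) (hta : t ≤ a) :
    modelFun k p (bumpFun k p a b) t = 0 := by
  have h : EqOn (fun s => bumpFun k p a b s / fundSol k p s) (fun _ => 0) (uIcc 0 t) := fun s hs => by
    rw [uIcc_of_le ht0] at hs
    simp [bumpFun, indicator_of_notMem (fun h : s ∈ Ioc a b => by linarith [h.1, hs.2])]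
  rw [modelFun, intervalIntegral.integral_congr h]
  simp

theorem modelFun_bumpFun_of_ge (k : ℝ) (p : ℝ → ℝ) {a b t : ℝ} (ha : 0 ≤ a) (hab : a < b)
    (hbt : b ≤ t) : modelFun k p (bumpFun k p a b) t = fundSol k p t / fundSol k p b := by
  have h0t : (0 : ℝ) ≤ t := ha.trans (hab.le.trans hbt)
  have hsub : Ioc a b ∩ Ioc 0 t = Ioc a b := inter_eq_left.2 fun s hs =>
    ⟨ha.trans_lt hs.1, hs.2.trans hbt⟩
  simp only [modelFun, bumpFun_div_fundSol]
  rw [intervalIntegral.integral_of_le h0t, integral_indicator measurableSet_Ioc,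
    Measure.restrict_restrict measurableSet_Ioc, hsub, setIntegral_const, Real.volume_real_Ioc_of_le
    hab.le, smul_eq_mul]
  have h1 := (fundSol_pos k p b).ne'
  have h2 := (sub_pos.2 hab).ne'
  field_simp

theorem integral_bumpFun_le (hk : 0 < k) (hp : IsSingularCoeff p) {a b : ℝ} (ha : 0 < a)
    (hab : a < b) (hb : b ≤ 1) :
    ∫ s in (0 : ℝ)..1, bumpFun k p a b s ≤ fundSol k p a / fundSol k p b := by
  have hsub : Ioc a b ∩ Ioc 0 1 = Ioc a b := inter_eq_left.2 fun s hs =>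
    ⟨ha.trans hs.1, hs.2.trans hb⟩
  have hi : Integrable ((Ioc a b).indicator
      (fun _ : ℝ => fundSol k p a / (fundSol k p b * (b - a)))) :=
    (integrable_indicator_iff measurableSet_Ioc).2 (by simp [integrableOn_const_iff])
  refine (intervalIntegral.integral_mono zero_le_one (integrable_bumpFun k hp ha hb).intervalIntegrable
    hi.intervalIntegrable (bumpFun_le hk hp ha hab hb)).trans_eq ?_
  rw [intervalIntegral.integral_of_le zero_le_one, integral_indicator measurableSet_Ioc,
    Measure.restrict_restrict measurableSet_Ioc, hsub, setIntegral_const, Real.volume_real_Ioc_of_le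
    hab.le, smul_eq_mul]
  have h1 := (fundSol_pos k p b).ne'
  have h2 := (sub_pos.2 hab).ne'
  field_simp

/-- An approximate unit impulse at `b`: a bump on `(a,b]` has mass at most `x₁(a)/x₁(b)`, which
tends to `1` as `a` increases to `b`. -/
theorem exists_bump (hk : 0 < k) (hp : IsSingularCoeff p) {a₀ b ε : ℝ} (ha₀ : 0 < a₀)
    (hab : a₀ < b) (hb : b ≤ 1) (hε : 0 < ε) :
    ∃ w : SpaceL, 0 ≤ w ∧ ‖w‖ ≤ 1 + ε ∧
      (∀ t : Icc (0 : ℝ) 1, (t : ℝ) ≤ a₀ → solOp hk hp w t = 0) ∧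
      ∀ t : Icc (0 : ℝ) 1, b ≤ t → solOp hk hp w t = fundSol k p t / fundSol k p b := by
  have hE := fundSol_pos k p b
  have hc : ContinuousWithinAt (fundSol k p) (Ioo a₀ b) b :=
    (continuousOn_fundSol k hp b ⟨ha₀.trans hab, hb⟩).mono
      fun s hs => ⟨ha₀.trans hs.1, hs.2.le.trans hb⟩
  have hev : ∀ᶠ s in 𝓝[Ioo a₀ b] b, fundSol k p s < fundSol k p b * (1 + ε) :=
    hc.eventually (gt_mem_nhds (by nlinarith))
  have : (𝓝[Ioo a₀ b] b).NeBot := by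
    rw [nhdsWithin_Ioo_eq_nhdsLT hab]; infer_instance
  obtain ⟨a, haE, ha⟩ := (hev.and self_mem_nhdsWithin).exists
  have ha0 : 0 < a := ha₀.trans ha.1
  have hint : Integrable (bumpFun k p a b) (volume.restrict (Icc (0 : ℝ) 1)) :=
    (integrable_bumpFun k hp ha0 hb).integrableOn
  have hcoe := hint.coeFn_toL1
  refine ⟨hint.toL1 _, ?_, ?_, fun t ht => ?_, fun t ht => ?_⟩
  · rw [← Lp.coeFn_nonneg]
    filter_upwards [hcoe] with s hs
    rw [hs]
    exact bumpFun_nonneg _ _ _ _ _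
  · rw [L1.norm_of_fun_eq_integral_norm, integral_Icc_eq_integral_Ioc,
      ← intervalIntegral.integral_of_le zero_le_one]
    simp only [Real.norm_of_nonneg (bumpFun_nonneg _ _ _ _ _)]
    refine (integral_bumpFun_le hk hp ha0 ha.2 hb).trans ?_
    rw [div_le_iff₀ hE]
    linarith
  · rw [solOp_apply, modelFun_congr_ae hcoe t.2,
      modelFun_bumpFun_of_le k p t.2.1 (ht.trans ha.1.le)]
  · rw [solOp_apply, modelFun_congr_ae hcoe t.2, modelFun_bumpFun_of_ge k p ha0.le ha.2 ht]

/-! ### Necessity: rank one operators and counterexamples -/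

/-- The rank one operator `x ↦ x(t) u`. -/
def evalOp (t : Icc (0 : ℝ) 1) (u : SpaceL) : SpaceC →L[ℝ] SpaceL :=
  (ContinuousMap.evalCLM ℝ t).smulRight u

theorem evalOp_apply (t : Icc (0 : ℝ) 1) (u : SpaceL) (x : SpaceC) : evalOp t u x = x t • u := rfl

theorem isPositiveOp_iff {T : SpaceC →L[ℝ] SpaceL} :
    IsPositiveOp T ↔ ∀ x : SpaceC, (∀ t, 0 ≤ x t) → 0 ≤ T x := by
  simp only [IsPositiveOp, ← Lp.coeFn_nonneg]
  rfl

theorem smul_nonneg_spaceL {c : ℝ} (hc : 0 ≤ c) {u : SpaceL} (hu : 0 ≤ u) : 0 ≤ c • u := by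
  rw [← Lp.coeFn_nonneg] at hu ⊢
  filter_upwards [hu, Lp.coeFn_smul c u] with t h1 h2
  rw [h2]
  exact mul_nonneg hc h1

theorem isPositiveOp_evalOp (t : Icc (0 : ℝ) 1) {u : SpaceL} (hu : 0 ≤ u) :
    IsPositiveOp (evalOp t u) :=
  isPositiveOp_iff.2 fun _ hx => smul_nonneg_spaceL (hx t) hu

theorem IsPositiveOp.add {S T : SpaceC →L[ℝ] SpaceL} (hS : IsPositiveOp S) (hT : IsPositiveOp T) :
    IsPositiveOp (S + T) :=
  isPositiveOp_iff.2 fun x hx => add_nonneg (isPositiveOp_iff.1 hS x hx) (isPositiveOp_iff.1 hT x hx)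

theorem IsPositiveOp.norm_add {S T : SpaceC →L[ℝ] SpaceL} (hS : IsPositiveOp S)
    (hT : IsPositiveOp T) : ‖S + T‖ = ‖S‖ + ‖T‖ := by
  rw [(hS.add hT).norm_eq_integral, hS.norm_eq_integral, hT.norm_eq_integral,
    ← intervalIntegral.integral_add (intervalIntegrable_coe _) (intervalIntegrable_coe _)]
  refine intervalIntegral.integral_congr_ae ?_
  filter_upwards [(ae_restrict_iff' measurableSet_Icc).1 (Lp.coeFn_add (S 1) (T 1))] with s hs hsm
  rw [uIoc_of_le zero_le_one] at hsm
  exact hs ⟨hsm.1.le, hsm.2⟩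

theorem norm_evalOp {t : Icc (0 : ℝ) 1} {u : SpaceL} (hu : 0 ≤ u) : ‖evalOp t u‖ = ‖u‖ := by
  rw [(isPositiveOp_evalOp t hu).norm_eq, evalOp_apply]
  simp

theorem exists_nonneg_norm_eq {c : ℝ} (hc : 0 ≤ c) : ∃ u : SpaceL, 0 ≤ u ∧ ‖u‖ = c := by
  have hint : Integrable (fun _ : ℝ => c) (volume.restrict (Icc (0 : ℝ) 1)) := by simp
  refine ⟨hint.toL1 _, ?_, ?_⟩
  · rw [← Lp.coeFn_nonneg]
    filter_upwards [hint.coeFn_toL1] with s hs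
    rw [hs]
    exact hc
  · rw [L1.norm_of_fun_eq_integral_norm]
    simp [abs_of_nonneg hc]

/-- A positive operator can be given any larger norm without changing it on the functions
vanishing at `0`. -/
theorem IsPositiveOp.exists_norm_eq {S : SpaceC →L[ℝ] SpaceL} (hS : IsPositiveOp S) {τ : ℝ}
    (hτ : ‖S‖ ≤ τ) : ∃ T : SpaceC →L[ℝ] SpaceL, IsPositiveOp T ∧ ‖T‖ = τ ∧
      ∀ x : SpaceC, x ⟨0, le_rfl, zero_le_one⟩ = 0 → T x = S x := by
  obtain ⟨u, hu, hnu⟩ := exists_nonneg_norm_eq (sub_nonneg.2 hτ)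
  have hE := isPositiveOp_evalOp ⟨0, le_rfl, zero_le_one⟩ hu
  refine ⟨S + evalOp ⟨0, le_rfl, zero_le_one⟩ u, hS.add hE, ?_, fun x hx => ?_⟩
  · rw [hS.norm_add hE, norm_evalOp hu, hnu]
    ring
  · rw [add_apply, evalOp_apply, hx, zero_smul, add_zero]

theorem exists_not_isUniquelySolvable (hk : 0 < k) (hp : IsSingularCoeff p) {τp τm : ℝ}
    {Sp Sm : SpaceC →L[ℝ] SpaceL} (hSp : IsPositiveOp Sp) (hSm : IsPositiveOp Sm)
    (hSp' : ‖Sp‖ ≤ τp) (hSm' : ‖Sm‖ ≤ τm) {x : SpaceC} (hx : x = solOp hk hp (Sp x - Sm x))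
    (hne : x ≠ 0) : ∃ Tp Tm : SpaceC →L[ℝ] SpaceL, IsPositiveOp Tp ∧ IsPositiveOp Tm ∧
      ‖Tp‖ = τp ∧ ‖Tm‖ = τm ∧ ¬ IsUniquelySolvable k p (Tp - Tm) := by
  obtain ⟨Tp, hTp, hnp, hTp'⟩ := hSp.exists_norm_eq hSp'
  obtain ⟨Tm, hTm, hnm, hTm'⟩ := hSm.exists_norm_eq hSm'
  refine ⟨Tp, Tm, hTp, hTm, hnp, hnm, fun h => hne ?_⟩
  have hx0 : x ⟨0, le_rfl, zero_le_one⟩ = 0 := by rw [hx, solOp_apply, modelFun_zero]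
  refine (h 0).unique ((isCauchySolution_iff hk hp _ _ _).2 ?_)
    ((isCauchySolution_iff hk hp _ _ _).2 ?_)
  · rw [add_zero, sub_apply, hTp' x hx0, hTm' x hx0]
    exact hx
  · simp

/-- The extremal configuration: the solution equals `1` at `t₁`, and then `γ - δ` at `1`. -/
theorem exists_not_isUniquelySolvable_of_bumps (hk : 0 < k) (hp : IsSingularCoeff p)
    {τp τm α β γ δ : ℝ} {w₁ w₂ : SpaceL} {t₁ t₂ : Icc (0 : ℝ) 1} (hα : 0 ≤ α) (hβ : 0 ≤ β)
    (hδ : 0 ≤ δ) (hw₁ : 0 ≤ w₁) (hw₂ : 0 ≤ w₂) (h11 : solOp hk hp w₁ t₁ = 1)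
    (h12 : solOp hk hp w₁ t₂ = γ) (h21 : solOp hk hp w₂ t₁ = 0) (h22 : solOp hk hp w₂ t₂ = 1)
    (heq : 1 = α + β * (δ - γ)) (hp1 : α * ‖w₁‖ ≤ τp) (hm1 : β * ‖w₁‖ + δ * ‖w₂‖ ≤ τm) :
    ∃ Tp Tm : SpaceC →L[ℝ] SpaceL, IsPositiveOp Tp ∧ IsPositiveOp Tm ∧
      ‖Tp‖ = τp ∧ ‖Tm‖ = τm ∧ ¬ IsUniquelySolvable k p (Tp - Tm) := by
  have hαw := smul_nonneg_spaceL hα hw₁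
  have hβw := smul_nonneg_spaceL hβ hw₁
  have hδw := smul_nonneg_spaceL hδ hw₂
  -- With `S⁺x = α x(t₁) w₁` and `S⁻x = β x(t₂) w₁ + δ x(t₁) w₂`, the values of `x` give `S⁺x - S⁻x
  -- = (α + β(δ - γ)) w₁ - δ w₂`; `heq` makes the first coefficient `1`.
  set x : SpaceC := solOp hk hp (w₁ - δ • w₂) with hx
  have hx1 : x t₁ = 1 := by simp [hx, h11, h21]
  have hx2 : x t₂ = γ - δ := by simp [hx, h12, h22]
  refine exists_not_isUniquelySolvable hk hp (x := x) (isPositiveOp_evalOp t₁ hαw)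
    ((isPositiveOp_evalOp t₂ hβw).add (isPositiveOp_evalOp t₁ hδw)) ?_ ?_ ?_ ?_
  · rwa [norm_evalOp hαw, norm_smul, Real.norm_of_nonneg hα]
  · rwa [(isPositiveOp_evalOp t₂ hβw).norm_add (isPositiveOp_evalOp t₁ hδw), norm_evalOp hβw,
      norm_evalOp hδw, norm_smul, norm_smul, Real.norm_of_nonneg hβ, Real.norm_of_nonneg hδ]
  · rw [add_apply, evalOp_apply, evalOp_apply, evalOp_apply, hx1, hx2, hx]
    congr 1
    have : w₁ = (α + β * (δ - γ)) • w₁ := by rw [← heq, one_smul]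
    nth_rewrite 1 [this]
    module
  · intro h
    rw [h] at hx1
    simp at hx1

theorem exists_not_isUniquelySolvable_of_one_lt (hk : 0 < k) (hp : IsSingularCoeff p) {τp τm : ℝ}
    (h : 1 < τp) (hτm : 0 ≤ τm) :
    ∃ Tp Tm : SpaceC →L[ℝ] SpaceL, IsPositiveOp Tp ∧ IsPositiveOp Tm ∧
      ‖Tp‖ = τp ∧ ‖Tm‖ = τm ∧ ¬ IsUniquelySolvable k p (Tp - Tm) := by
  obtain ⟨w₁, hw₁, hn₁, -, h1⟩ := exists_bump hk hp (a₀ := 1 / 4) (b := 1 / 2) (by norm_num)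
    (by norm_num) (by norm_num) (sub_pos.2 h)
  obtain ⟨w₂, hw₂, -, h2, h3⟩ := exists_bump hk hp (a₀ := 1 / 2) (b := 1) (by norm_num)
    (by norm_num) le_rfl one_pos
  have hE := (fundSol_pos k p (1 / 2)).ne'
  exact exists_not_isUniquelySolvable_of_bumps hk hp (t₁ := ⟨1 / 2, by norm_num, by norm_num⟩)
    (t₂ := ⟨1, by norm_num, by norm_num⟩) zero_le_one le_rfl le_rfl hw₁ hw₂
    ((h1 _ le_rfl).trans (div_self hE)) rfl (h2 _ le_rfl)
    ((h3 _ le_rfl).trans (div_self (fundSol_pos k p 1).ne')) (by simp) (by linarith) (by simpa)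

theorem exists_not_isUniquelySolvable_of_sqrt_lt (hk : 0 < k) (hp : IsSingularCoeff p) {τp τm : ℝ}
    (hτp : 0 ≤ τp) (h1 : τp ≤ 1) (h : 2 * √(1 - τp) < τm) :
    ∃ Tp Tm : SpaceC →L[ℝ] SpaceL, IsPositiveOp Tp ∧ IsPositiveOp Tm ∧
      ‖Tp‖ = τp ∧ ‖Tm‖ = τm ∧ ¬ IsUniquelySolvable k p (Tp - Tm) := by
  -- The left side bounds the norm of the negative part built below and tends to `2√(1 - τp)` as `ε
  -- → 0`.
  obtain ⟨ε, hετ, hε⟩ : ∃ ε : ℝ, (2 * √(1 - τp / (1 + ε)) + ε) * (1 + ε) < τm ∧ 0 < ε := by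
    have hc : ContinuousAt (fun ε : ℝ => (2 * √(1 - τp / (1 + ε)) + ε) * (1 + ε)) 0 := by
      have : ContinuousAt (fun ε : ℝ => τp / (1 + ε)) 0 :=
        continuousAt_const.div (by fun_prop) (by norm_num)
      fun_prop
    have hev := hc.tendsto.eventually_lt_const (u := τm) (by simpa using h)
    exact ((hev.filter_mono nhdsWithin_le_nhds).and
      (self_mem_nhdsWithin : Ioi (0 : ℝ) ∈ 𝓝[>] 0)).exists
  -- The singularity enters here: `x₁(t) ≥ 1/ε` leaves at most `ε` of the first impulse at time `1`.
  obtain ⟨t, ⟨htE, ht1⟩, ht0⟩ : ∃ t : ℝ, (ε⁻¹ ≤ fundSol k p t ∧ t < 1) ∧ 0 < t :=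
    ((((tendsto_fundSol hk hp).eventually_ge_atTop ε⁻¹).and
      (nhdsWithin_le_nhds (gt_mem_nhds one_pos))).and
      (self_mem_nhdsWithin : Ioi (0 : ℝ) ∈ 𝓝[>] 0)).exists
  obtain ⟨w₁, hw₁, hn₁, -, hb₁⟩ := exists_bump hk hp (half_pos ht0) (half_lt_self ht0) ht1.le hε
  obtain ⟨w₂, hw₂, hn₂, ha₂, hb₂⟩ := exists_bump hk hp ht0 ht1 le_rfl hε
  have hEt := fundSol_pos k p t
  set γ := fundSol k p 1 / fundSol k p t with hγ
  have hγ0 : 0 < γ := fundSol_div_pos k p t 1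
  have hγε : γ ≤ ε := by
    rw [hγ, fundSol_one, one_div]
    exact inv_le_of_inv_le₀ hε htE
  -- The factor `1 + ε` absorbs the mass of the bump. With `δ = β + γ` the closing condition becomes
  -- `β² = 1 - α`, and the negative part has the nearly equal coefficients `β` and `β + γ`, close to
  -- equality in the arithmetic-geometric mean step.
  set α := τp / (1 + ε) with hα
  have hα0 : 0 ≤ α := by positivity
  have hα1 : α ≤ 1 := (div_le_one (by positivity)).2 (by linarith)
  set β := √(1 - α) with hβ
  have hβ0 : 0 ≤ β := Real.sqrt_nonneg _
  have hβ2 : β * β = 1 - α := Real.mul_self_sqrt (by linarith)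
  refine exists_not_isUniquelySolvable_of_bumps hk hp (t₁ := ⟨t, ht0.le, ht1.le⟩)
    (t₂ := ⟨1, by norm_num, by norm_num⟩) (α := α) (β := β) (γ := γ) (δ := β + γ) hα0 hβ0
    (by positivity) hw₁ hw₂
    ((hb₁ _ le_rfl).trans (div_self hEt.ne')) (hb₁ _ ht1.le) (ha₂ _ le_rfl)
    ((hb₂ _ le_rfl).trans (div_self (fundSol_pos k p 1).ne')) ?_ ?_ ?_
  · rw [add_sub_cancel_right, hβ2]
    ring
  · refine (mul_le_mul_of_nonneg_left hn₁ hα0).trans_eq ?_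
    rw [hα]
    field_simp
  · calc β * ‖w₁‖ + (β + γ) * ‖w₂‖ ≤ β * (1 + ε) + (β + ε) * (1 + ε) := by gcongr
      _ ≤ τm := by linarith

end SingularFDE

end

theorem mainTheorem3 (k : ℝ) (hk : 0 < k) (p : ℝ → ℝ) (hp : SingularFDE.IsSingularCoeff p)
    (τp τm : ℝ) (hτp : 0 ≤ τp) (hτm : 0 ≤ τm) :
    (∀ Tp Tm : SingularFDE.SpaceC →L[ℝ] SingularFDE.SpaceL,
        SingularFDE.IsPositiveOp Tp → SingularFDE.IsPositiveOp Tm →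
        ‖Tp‖ = τp → ‖Tm‖ = τm →
        SingularFDE.IsUniquelySolvable k p (Tp - Tm)) ↔
      τp ≤ 1 ∧ τm ≤ 2 * √(1 - τp) := by
  constructor
  · intro H
    have h1 : τp ≤ 1 := by
      by_contra! h
      obtain ⟨Tp, Tm, hTp, hTm, hnp, hnm, hns⟩ :=
        SingularFDE.exists_not_isUniquelySolvable_of_one_lt hk hp h hτm
      exact hns (H Tp Tm hTp hTm hnp hnm)
    refine ⟨h1, ?_⟩
    by_contra! h
    obtain ⟨Tp, Tm, hTp, hTm, hnp, hnm, hns⟩ :=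
      SingularFDE.exists_not_isUniquelySolvable_of_sqrt_lt hk hp hτp h1 h
    exact hns (H Tp Tm hTp hTm hnp hnm)
  · rintro ⟨h1, h2⟩ Tp Tm hTp hTm hnp hnm
    exact SingularFDE.isUniquelySolvable_of_homogeneous hk hp _
      (SingularFDE.isCompactOperator_solOp_comp_sub hk hp hTp hTm)
      fun x hx => SingularFDE.eq_zero_of_homogeneous hk hp hTp hTm hnp.le hnm.le h1 h2 hx
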